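/- Let $d,r\ge 1$ be integers, let $X$ be a set, and let $\binom{X}{r}$ denote the family of all $r$-element subsets of $X$. For real $x$ and an integer $k\ge 0$ put $\binom{x}{k}=x(x-1)\cdots(x-k+1)/k!$. Let $\mathcal F\subset\binom{X}{r}^d$ be a finite family of $d$-tuples of $r$-element subsets of $X$, and let its shadow be $$\partial\mathcal F=\{(S_1\setminus\{x_1\},\dots,S_d\setminus\{x_d\}) : (S_1,\dots,S_d)\in\mathcal F,\ x_i\in S_i \text{ for } i=1,\dots,d\}.$$ Suppose that $|\mathcal F|=\binom{x}{r}^d$ for a real number $x\ge r$. Then $$|\partial\mathcal F|\ge\binom{x}{r-1}^d.$$ Moreover, if $r\ge 2$ or $d=1$, then equality $|\partial\mathcal F|=\binom{x}{r-1}^d$ holds only if $\mathcal F=\binom{Y_1}{r}\times\dots\times\binom{Y_d}{r}$ for some sets $Y_1,\dots,Y_d\subset X$. -/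

import Mathlib

/-- The generalized binomial coefficient `x (x - 1) ⋯ (x - k + 1) / k!` of a real number `x`. -/
noncomputable def realBinom (x : ℝ) (k : ℕ) : ℝ :=
  (∏ i ∈ Finset.range k, (x - (i : ℝ))) / (Nat.factorial k : ℝ)

/-- The shadow of a finite family of `d`-tuples of finite sets: all tuples
`(S₁ \ {x₁}, …, S_d \ {x_d})` with `(S₁, …, S_d)` in the family and `xᵢ ∈ Sᵢ` for every `i`. -/
def tupleShadow {X : Type*} [DecidableEq X] {d : ℕ} (F : Finset (Fin d → Finset X)) :
    Finset (Fin d → Finset X) :=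
  F.biUnion fun S => (Fintype.piFinset S).image fun x i => S i \ {x i}

/-- The product family of all `d`-tuples `(S₁, …, S_d)` in which every `Sᵢ` is an `r`-element
subset of `Yᵢ`. -/
def productFamily {X : Type*} {d : ℕ} (r : ℕ) (Y : Fin d → Finset X) :
    Finset (Fin d → Finset X) :=
  Fintype.piFinset fun i => Finset.powersetCard r (Y i)

/-!
The proof is by entropy, for `d ≥ 1`; for `d = 0` the only tuple is the empty one. Order every set
of a uniformly random member of `F` uniformly at random, let `V_j` be the `d`-tuple of the `j`-th
elements, and put `a_j = exp (H(V_j | V_0, …, V_{j-1}) / d)` (`effectiveChoices`). Then `∏_{j < r}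
a_j ^ d = |F| (r!) ^ d = ∏_{j < r} (x - j) ^ d`, whereas `V_0, …, V_{r-2}` is an ordering of a
member of the shadow, so that `∏_{j < r - 1} a_j ^ d ≤ |∂F| ((r - 1)!) ^ d`. It therefore suffices
that `a_{r-1} ≤ x - r + 1`, and this follows from `a_j ≥ a_{j+1} + 1`
(`effectiveChoices_succ_add_one_le`).

To compare `a_j` with `a_{j+1}`, toss for each of the `d` indices an independent coin and let `Z`
consist of the coordinates of `V_{j+1}` at the set `B` of indices where the coin succeeds, and of
those of `V_j` elsewhere. By symmetry `Z` has the same joint distribution with `V_0, …, V_{j-1}`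
as `V_j`, so conditioning on `V_j` as well shows `H(V_j | V_{<j}) ≥ H(Z | V_{≤j})`. As `V_j` and
`V_{j+1}` differ in every coordinate, `Z` and `V_j` determine `B`; hence the right side is the
entropy of the coins plus the mean of the conditional entropies of `V_{j+1}` restricted to `B`.
The latter is bounded below by the Shearer-type inequality `mul_le_sum_bernoulliWeight`, and the
optimal coin bias gives `d log (1 + a_{j+1})` (`le_entropy_swapped`, `mul_log_one_add_le`).

In the case of equality with `r ≥ 2`, `a_0 = x` and `a_1 = x - 1`, and the mixture `Z` of `V_0`
and `V_1` is independent of `V_0`. For a single index `i` this says that `P(V_0^i = v)^2 = P(Z^i =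
V_0^i = v) = P(V_0^i = v) / x`, so `V_0^i` is uniform on a set `Y_i` of exactly `x` elements
(`fiberMass_coord_of_entropy_eq`). Now `F` lies in the product family of the `Y_i`, which has
`|F|` members.
-/

/-! ### Entropy of functions on a finite weighted space -/

section Entropy

variable {Ω α β γ δ : Type*} [Fintype Ω]

open Classical in
/-- The mass of the fibre of `f` through `ω`: the probability that `f` takes the value `f ω`, where
`p` is a weight function on the finite sample space `Ω`. -/
noncomputable def fiberMass (p : Ω → ℝ) (f : Ω → α) (ω : Ω) : ℝ :=
  ∑ ω', if f ω' = f ω then p ω' else 0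

/-- The Shannon entropy (in nats) of the random variable `f` under the weight function `p`. It is
written as a sum over the sample space rather than over the values of `f`, so that it visibly
depends only on the partition of `Ω` into fibres of `f`. -/
noncomputable def entropy (p : Ω → ℝ) (f : Ω → α) : ℝ :=
  -∑ ω, p ω * Real.log (fiberMass p f ω)

lemma le_fiberMass {p : Ω → ℝ} (hp : ∀ ω, 0 < p ω) (f : Ω → α) (ω : Ω) :
    p ω ≤ fiberMass p f ω := by
  classical
  have h := Finset.single_le_sum (f := fun ω' => if f ω' = f ω then p ω' else 0)
    (fun i _ => by split_ifs <;> [exact (hp i).le; exact le_rfl]) (Finset.mem_univ ω)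
  simpa [fiberMass] using h

lemma fiberMass_pos {p : Ω → ℝ} (hp : ∀ ω, 0 < p ω) (f : Ω → α) (ω : Ω) :
    0 < fiberMass p f ω :=
  (hp ω).trans_le (le_fiberMass hp f ω)

lemma fiberMass_eq_of_eq (p : Ω → ℝ) {f : Ω → α} {x y : Ω} (h : f x = f y) :
    fiberMass p f x = fiberMass p f y := by
  rw [fiberMass, fiberMass, h]

lemma fiberMass_of_injective (p : Ω → ℝ) {f : Ω → α} (hf : Function.Injective f) (ω : Ω) :
    fiberMass p f ω = p ω := by
  classical
  simp [fiberMass, hf.eq_iff]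

lemma fiberMass_of_const (p : Ω → ℝ) {f : Ω → α} (hf : ∀ x y, f x = f y) (ω : Ω) :
    fiberMass p f ω = ∑ ω', p ω' := by
  classical
  simp [fiberMass, hf _ ω]

lemma fiberMass_comp_equiv {p : Ω → ℝ} (σ : Ω ≃ Ω) (hσ : ∀ ω, p (σ ω) = p ω) (f : Ω → α)
    (ω : Ω) : fiberMass p (fun x => f (σ x)) ω = fiberMass p f (σ ω) := by
  classical
  rw [fiberMass, fiberMass,
    ← Equiv.sum_comp σ (fun ω' => if f ω' = f (σ ω) then p ω' else 0)]
  simp only [hσ]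

lemma entropy_comp_equiv {p : Ω → ℝ} (σ : Ω ≃ Ω) (hσ : ∀ ω, p (σ ω) = p ω) (f : Ω → α) :
    entropy p (fun x => f (σ x)) = entropy p f := by
  rw [entropy, entropy, ← Equiv.sum_comp σ (fun ω => p ω * Real.log (fiberMass p f ω))]
  simp only [hσ, fiberMass_comp_equiv σ hσ]

lemma entropy_of_const {p : Ω → ℝ} (hp : ∑ ω, p ω = 1) {f : Ω → α} (hf : ∀ x y, f x = f y) :
    entropy p f = 0 := by
  simp [entropy, fiberMass_of_const p hf, hp]

lemma sum_div_fiberMass_le_one {p : Ω → ℝ} (hp : ∀ ω, 0 < p ω) (f : Ω → α) (s : Finset Ω)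
    (hs : ∀ x ∈ s, ∀ y ∈ s, f x = f y) : ∑ ω ∈ s, p ω / fiberMass p f ω ≤ 1 := by
  classical
  rcases s.eq_empty_or_nonempty with rfl | ⟨z, hz⟩
  · simp
  · rw [Finset.sum_congr rfl fun ω hω => by rw [fiberMass_eq_of_eq p (hs ω hω z hz)],
      ← Finset.sum_div, div_le_one (fiberMass_pos hp f z), fiberMass, ← Finset.sum_filter]
    exact Finset.sum_le_sum_of_subset_of_nonneg
      (fun ω hω => by simpa using hs ω hω z hz) fun i _ _ => (hp i).le

lemma sum_div_fiberMass {p : Ω → ℝ} (hp : ∀ ω, 0 < p ω) (f : Ω → α) [DecidableEq α] :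
    ∑ ω, p ω / fiberMass p f ω = (Finset.univ.image f).card := by
  rw [← Finset.sum_fiberwise_of_maps_to (t := Finset.univ.image f) (g := f)
    (fun i _ => Finset.mem_image_of_mem f (Finset.mem_univ i)), Finset.card_eq_sum_ones,
    Nat.cast_sum]
  refine Finset.sum_congr rfl fun a ha => ?_
  obtain ⟨z, -, rfl⟩ := Finset.mem_image.1 ha
  rw [Finset.sum_congr rfl fun ω hω => by
      rw [fiberMass_eq_of_eq p (Finset.mem_filter.1 hω).2], ← Finset.sum_div, Nat.cast_one,
    div_eq_one_iff_eq (fiberMass_pos hp f z).ne', fiberMass, Finset.sum_filter]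
  exact Finset.sum_congr rfl fun ω _ => by congr

/-- The ratio whose expected logarithm is the conditional mutual information has mean at most `1`:
its mean is the total mass of the coupling in which `f` and `g` are made independent given `h`. -/
lemma sum_mul_fiberMass_ratio_le {p : Ω → ℝ} (hp : ∀ ω, 0 < p ω) {fg : Ω → α} {f : Ω → β}
    {g : Ω → γ} {h : Ω → δ} (hfg : ∀ x y, fg x = fg y ↔ f x = f y ∧ g x = g y)
    (hf : ∀ x y, f x = f y → h x = h y) (hg : ∀ x y, g x = g y → h x = h y) :
    ∑ ω, p ω * (fiberMass p f ω * fiberMass p g ω / (fiberMass p fg ω * fiberMass p h ω))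
      ≤ ∑ ω, p ω := by
  classical
  have key : ∀ ω, p ω * (fiberMass p f ω * fiberMass p g ω /
      (fiberMass p fg ω * fiberMass p h ω)) = ∑ x, ∑ y,
        if f x = f ω ∧ g y = g ω then p x * p y / fiberMass p h x * (p ω / fiberMass p fg ω)
        else 0 := by
    intro ω
    have h1 : fiberMass p f ω * fiberMass p g ω =
        ∑ x, ∑ y, if f x = f ω ∧ g y = g ω then p x * p y else 0 := by
      rw [fiberMass, fiberMass, Finset.sum_mul_sum]
      refine Finset.sum_congr rfl fun x _ => Finset.sum_congr rfl fun y _ => ?_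
      by_cases h1 : f x = f ω <;> by_cases h2 : g y = g ω <;> simp [h1, h2]
    rw [h1, Finset.sum_div, Finset.mul_sum]
    refine Finset.sum_congr rfl fun x _ => ?_
    rw [Finset.sum_div, Finset.mul_sum]
    refine Finset.sum_congr rfl fun y _ => ?_
    split_ifs with hxy
    · rw [fiberMass_eq_of_eq p (hf _ _ hxy.1)]
      have := (fiberMass_pos hp h ω).ne'
      have := (fiberMass_pos hp fg ω).ne'
      field_simp
    · simp
  have inner : ∀ x y, (∑ ω, if f x = f ω ∧ g y = g ω then
      p x * p y / fiberMass p h x * (p ω / fiberMass p fg ω) else 0) ≤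
        if h y = h x then p x * p y / fiberMass p h x else 0 := by
    intro x y
    rw [← Finset.sum_filter, ← Finset.mul_sum]
    have hc : 0 ≤ p x * p y / fiberMass p h x :=
      div_nonneg (mul_nonneg (hp x).le (hp y).le) (fiberMass_pos hp h x).le
    split_ifs with hxy
    · refine mul_le_of_le_one_right hc (sum_div_fiberMass_le_one hp fg _ ?_)
      intro a ha b hb
      simp only [Finset.mem_filter, Finset.mem_univ, true_and] at ha hb
      exact (hfg a b).2 ⟨ha.1.symm.trans hb.1, ha.2.symm.trans hb.2⟩
    · rw [Finset.filter_eq_empty_iff.2, Finset.sum_empty, mul_zero]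
      rintro ω - ⟨h1, h2⟩
      exact hxy ((hg _ _ h2).trans (hf _ _ h1).symm)
  calc _ = ∑ x, ∑ y, ∑ ω, if f x = f ω ∧ g y = g ω then
          p x * p y / fiberMass p h x * (p ω / fiberMass p fg ω) else 0 := by
        simp only [key]
        rw [Finset.sum_comm]
        exact Finset.sum_congr rfl fun x _ => Finset.sum_comm
    _ ≤ ∑ x, ∑ y, if h y = h x then p x * p y / fiberMass p h x else 0 :=
        Finset.sum_le_sum fun x _ => Finset.sum_le_sum fun y _ => inner x y
    _ = ∑ x, p x := by
        refine Finset.sum_congr rfl fun x _ => ?_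
        have hx := (fiberMass_pos hp h x).ne'
        calc _ = p x / fiberMass p h x * ∑ y, if h y = h x then p y else 0 := by
              rw [Finset.mul_sum]
              refine Finset.sum_congr rfl fun y _ => ?_
              split_ifs <;> ring
          _ = p x / fiberMass p h x * fiberMass p h x := rfl
          _ = p x := by field_simp

lemma sum_mul_log_ratio {p : Ω → ℝ} (hp : ∀ ω, 0 < p ω) (fg : Ω → α) (f : Ω → β)
    (g : Ω → γ) (h : Ω → δ) :
    ∑ ω, p ω * Real.log
      (fiberMass p f ω * fiberMass p g ω / (fiberMass p fg ω * fiberMass p h ω)) =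
      entropy p fg + entropy p h - entropy p f - entropy p g := by
  simp only [entropy]
  rw [sub_neg_eq_add, sub_neg_eq_add, ← neg_add, neg_add_eq_sub, sub_add_eq_add_sub,
    ← Finset.sum_add_distrib, ← Finset.sum_add_distrib, ← Finset.sum_sub_distrib]
  refine Finset.sum_congr rfl fun ω _ => ?_
  have h1 := (fiberMass_pos hp f ω).ne'
  have h2 := (fiberMass_pos hp g ω).ne'
  have h3 := (fiberMass_pos hp fg ω).ne'
  have h4 := (fiberMass_pos hp h ω).ne'
  rw [Real.log_div (mul_ne_zero h1 h2) (mul_ne_zero h3 h4), Real.log_mul h1 h2,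
    Real.log_mul h3 h4]
  ring

/-- Submodularity of entropy, i.e. nonnegativity of the conditional mutual information of `f` and
`g` given `h`. The hypotheses say that `fg` carries the joint information of `f` and `g`, and that
`h` is a function both of `f` and of `g`. -/
theorem entropy_submodular {p : Ω → ℝ} (hp : ∀ ω, 0 < p ω) {fg : Ω → α} {f : Ω → β}
    {g : Ω → γ} {h : Ω → δ} (hfg : ∀ x y, fg x = fg y ↔ f x = f y ∧ g x = g y)
    (hf : ∀ x y, f x = f y → h x = h y) (hg : ∀ x y, g x = g y → h x = h y) :
    entropy p fg + entropy p h ≤ entropy p f + entropy p g := by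
  have h1 := sum_mul_log_ratio hp fg f g h
  have h2 := sum_mul_fiberMass_ratio_le hp hfg hf hg
  have h3 : ∀ ω ∈ Finset.univ, p ω * Real.log
      (fiberMass p f ω * fiberMass p g ω / (fiberMass p fg ω * fiberMass p h ω)) ≤
      p ω * (fiberMass p f ω * fiberMass p g ω / (fiberMass p fg ω * fiberMass p h ω)) - p ω := by
    intro ω _
    have := mul_le_mul_of_nonneg_left (Real.log_le_sub_one_of_pos (x :=
      fiberMass p f ω * fiberMass p g ω / (fiberMass p fg ω * fiberMass p h ω))
      (div_pos (mul_pos (fiberMass_pos hp f ω) (fiberMass_pos hp g ω))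
        (mul_pos (fiberMass_pos hp fg ω) (fiberMass_pos hp h ω)))) (hp ω).le
    linarith
  have h4 := Finset.sum_le_sum h3
  rw [Finset.sum_sub_distrib] at h4
  linarith

/-- The equality case of `entropy_submodular`: `f` and `g` are conditionally independent given
`h`. -/
theorem fiberMass_mul_eq_of_entropy_eq {p : Ω → ℝ} (hp : ∀ ω, 0 < p ω) {fg : Ω → α} {f : Ω → β}
    {g : Ω → γ} {h : Ω → δ} (hfg : ∀ x y, fg x = fg y ↔ f x = f y ∧ g x = g y)
    (hf : ∀ x y, f x = f y → h x = h y) (hg : ∀ x y, g x = g y → h x = h y)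
    (heq : entropy p f + entropy p g ≤ entropy p fg + entropy p h) (ω : Ω) :
    fiberMass p f ω * fiberMass p g ω = fiberMass p fg ω * fiberMass p h ω := by
  have h1 := sum_mul_log_ratio hp fg f g h
  have h2 := sum_mul_fiberMass_ratio_le hp hfg hf hg
  set R : Ω → ℝ := fun ω =>
    fiberMass p f ω * fiberMass p g ω / (fiberMass p fg ω * fiberMass p h ω) with hR
  have hRpos : ∀ ω, 0 < R ω := fun ω =>
    div_pos (mul_pos (fiberMass_pos hp f ω) (fiberMass_pos hp g ω))
        (mul_pos (fiberMass_pos hp fg ω) (fiberMass_pos hp h ω))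
  have h3 : ∀ ω ∈ Finset.univ, 0 ≤ p ω * (R ω - 1 - Real.log (R ω)) := fun ω _ =>
    mul_nonneg (hp ω).le (by linarith [Real.log_le_sub_one_of_pos (hRpos ω)])
  have h4 : ∑ ω, p ω * (R ω - 1 - Real.log (R ω)) = 0 := by
    refine le_antisymm ?_ (Finset.sum_nonneg h3)
    have : ∑ ω, p ω * (R ω - 1 - Real.log (R ω)) =
        ∑ ω, p ω * R ω - ∑ ω, p ω - ∑ ω, p ω * Real.log (R ω) := by
      rw [← Finset.sum_sub_distrib, ← Finset.sum_sub_distrib]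
      exact Finset.sum_congr rfl fun ω _ => by ring
    rw [this]
    linarith
  have h5 := (Finset.sum_eq_zero_iff_of_nonneg h3).1 h4 ω (Finset.mem_univ ω)
  have h6 : R ω = 1 := by
    by_contra hne
    have := Real.log_lt_sub_one_of_pos (hRpos ω) hne
    rcases mul_eq_zero.1 h5 with h | h
    · exact (hp ω).ne' h
    · linarith
  exact (div_eq_one_iff_eq
    (mul_pos (fiberMass_pos hp fg ω) (fiberMass_pos hp h ω)).ne').1 h6

/-- The entropy of a random variable is at most the logarithm of the number of its values. -/
theorem entropy_le_log_card {κ : Type*} [Fintype κ] {p : Ω → ℝ} (hp : ∀ ω, 0 < p ω)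
    (hp1 : ∑ ω, p ω = 1) (f : Ω → α) (g : κ → α) (hfg : ∀ ω, ∃ k, g k = f ω) :
    entropy p f ≤ Real.log (Fintype.card κ) := by
  classical
  have hne : Nonempty Ω := by
    by_contra h
    rw [not_nonempty_iff] at h
    simp at hp1
  obtain ⟨k, -⟩ := hfg hne.some
  have hκ : (0 : ℝ) < Fintype.card κ := Nat.cast_pos.2 (Fintype.card_pos_iff.2 ⟨k⟩)
  have hcard : ((Finset.univ.image f).card : ℝ) ≤ Fintype.card κ := by
    refine Nat.cast_le.2 ((Finset.card_le_card (t := Finset.univ.image g) ?_).trans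
      Finset.card_image_le)
    intro a ha
    obtain ⟨ω, -, rfl⟩ := Finset.mem_image.1 ha
    obtain ⟨k, hk⟩ := hfg ω
    exact Finset.mem_image.2 ⟨k, Finset.mem_univ k, hk⟩
  rw [← sum_div_fiberMass hp f] at hcard
  have h3 : ∀ ω ∈ Finset.univ, -(p ω * Real.log (fiberMass p f ω)) -
      p ω * Real.log (Fintype.card κ) ≤ p ω / fiberMass p f ω / Fintype.card κ - p ω := by
    intro ω _
    have hm := fiberMass_pos hp f ω
    have := mul_le_mul_of_nonneg_left (Real.log_le_sub_one_of_pos (x :=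
      (fiberMass p f ω * Fintype.card κ)⁻¹) (inv_pos.2 (mul_pos hm hκ))) (hp ω).le
    rw [Real.log_inv, Real.log_mul hm.ne' hκ.ne'] at this
    have h5 : p ω / fiberMass p f ω / Fintype.card κ =
        p ω * (fiberMass p f ω * Fintype.card κ)⁻¹ := by
      rw [div_div, div_eq_mul_inv]
    rw [h5]
    linarith
  have h4 := Finset.sum_le_sum h3
  rw [Finset.sum_sub_distrib, Finset.sum_sub_distrib, ← Finset.sum_div, ← Finset.sum_mul, hp1,
    Finset.sum_neg_distrib] at h4
  have h5 := (div_le_one hκ).2 hcard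
  rw [entropy]
  linarith

end Entropy

/-! ### Independent coins -/

section Coins

variable {Ω C α β : Type*} [Fintype Ω] [Fintype C]

lemma fiberMass_prod_fst (p : Ω → ℝ) {w : C → ℝ} (hw : ∑ c, w c = 1) {f : Ω × C → α} {g : Ω → β}
    (h : ∀ x y, f x = f y ↔ g x.1 = g y.1) (x : Ω × C) :
    fiberMass (fun x : Ω × C => p x.1 * w x.2) f x = fiberMass p g x.1 := by
  classical
  rw [fiberMass, fiberMass, Fintype.sum_prod_type]
  refine Finset.sum_congr rfl fun ω _ => ?_
  simp only [h]
  split_ifs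
  · rw [← Finset.mul_sum, hw, mul_one]
  · simp

lemma entropy_prod_fst (p : Ω → ℝ) {w : C → ℝ} (hw : ∑ c, w c = 1) {f : Ω × C → α} {g : Ω → β}
    (h : ∀ x y, f x = f y ↔ g x.1 = g y.1) :
    entropy (fun x : Ω × C => p x.1 * w x.2) f = entropy p g := by
  simp only [entropy, fiberMass_prod_fst p hw h]
  rw [Fintype.sum_prod_type]
  congr 1
  refine Finset.sum_congr rfl fun ω _ => ?_
  simp only
  rw [← Finset.sum_mul, ← Finset.mul_sum, hw, mul_one]

/-- Conditioning on an independent coin `c` that can be read off from `f`. -/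
lemma entropy_prod_of_snd {p : Ω → ℝ} (hp : ∀ ω, 0 < p ω) (hp1 : ∑ ω, p ω = 1) {w : C → ℝ}
    (hw : ∀ c, 0 < w c) {β : C → Type*} {f : Ω × C → α} {g : ∀ c, Ω → β c}
    (h : ∀ x y, f x = f y ↔ x.2 = y.2 ∧ g x.2 x.1 = g x.2 y.1) :
    entropy (fun x : Ω × C => p x.1 * w x.2) f =
      ∑ c, w c * (-Real.log (w c) + entropy p (g c)) := by
  classical
  have hm : ∀ ω c, fiberMass (fun x : Ω × C => p x.1 * w x.2) f (ω, c) =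
      w c * fiberMass p (g c) ω := by
    intro ω c
    rw [fiberMass, fiberMass, Fintype.sum_prod_type, Finset.mul_sum]
    refine Finset.sum_congr rfl fun ω' _ => ?_
    rw [Finset.sum_eq_single c]
    · simp only [h, true_and]
      split_ifs <;> ring
    · intro c' _ hc
      simp [h, hc]
    · simp
  rw [entropy, Fintype.sum_prod_type_right, ← Finset.sum_neg_distrib]
  refine Finset.sum_congr rfl fun c _ => ?_
  simp only [hm]
  rw [entropy, mul_add, mul_neg, mul_neg, ← neg_add, neg_inj]
  calc _ = ∑ ω, (p ω * (w c * Real.log (w c)) + w c * (p ω * Real.log (fiberMass p (g c) ω))) := by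
        refine Finset.sum_congr rfl fun ω _ => ?_
        rw [Real.log_mul (hw c).ne' (fiberMass_pos hp _ ω).ne']
        ring
    _ = _ := by rw [Finset.sum_add_distrib, ← Finset.sum_mul, hp1, one_mul, Finset.mul_sum]

/-- The probability that the random subset of `S` containing each element independently with
probability `t` equals `B`. -/
noncomputable def bernoulliWeight {ι : Type*} (t : ℝ) (S B : Finset ι) : ℝ :=
  t ^ B.card * (1 - t) ^ (S.card - B.card)

lemma sum_bernoulliWeight {ι : Type*} (t : ℝ) (S : Finset ι) :
    ∑ B ∈ S.powerset, bernoulliWeight t S B = 1 := by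
  simp only [bernoulliWeight]
  rw [Finset.sum_pow_mul_eq_add_pow, add_sub_cancel, one_pow]

lemma sum_bernoulliWeight_insert {ι : Type*} [DecidableEq ι] (t : ℝ) {S : Finset ι} {i : ι}
    (hi : i ∉ S) (g : Finset ι → ℝ) :
    ∑ B ∈ (insert i S).powerset, bernoulliWeight t (insert i S) B * g B =
      (1 - t) * ∑ B ∈ S.powerset, bernoulliWeight t S B * g B +
      t * ∑ B ∈ S.powerset, bernoulliWeight t S B * g (insert i B) := by
  rw [Finset.sum_powerset_insert hi, Finset.mul_sum, Finset.mul_sum]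
  congr 1
  · refine Finset.sum_congr rfl fun B hB => ?_
    have := Finset.card_le_card (Finset.mem_powerset.1 hB)
    rw [bernoulliWeight, bernoulliWeight, Finset.card_insert_of_notMem hi,
      Nat.succ_sub this, pow_succ]
    ring
  · refine Finset.sum_congr rfl fun B hB => ?_
    rw [bernoulliWeight, bernoulliWeight, Finset.card_insert_of_notMem hi,
      Finset.card_insert_of_notMem fun h => hi (Finset.mem_powerset.1 hB h),
      Nat.add_sub_add_right, pow_succ]
    ring

/-- A Shearer-type inequality: the mean of a normalised submodular set function over a random subset
that contains each element with probability `t` is at least `t` times its value on the whole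
set. -/
theorem mul_le_sum_bernoulliWeight {ι : Type*} [DecidableEq ι] {t : ℝ} (ht0 : 0 ≤ t) (ht1 : t ≤ 1)
    (g : Finset ι → ℝ) (h0 : g ∅ = 0)
    (hg : ∀ B S i, B ⊆ S → i ∉ S → g (insert i S) + g B ≤ g (insert i B) + g S) (S : Finset ι) :
    t * g S ≤ ∑ B ∈ S.powerset, bernoulliWeight t S B * g B := by
  induction S using Finset.induction_on with
  | empty => simp [h0]
  | insert i S hi ih =>
    rw [sum_bernoulliWeight_insert t hi]
    have h1 : ∑ B ∈ S.powerset, bernoulliWeight t S B * (g (insert i S) + g B) ≤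
        ∑ B ∈ S.powerset, bernoulliWeight t S B * (g (insert i B) + g S) := by
      refine Finset.sum_le_sum fun B hB =>
        mul_le_mul_of_nonneg_left (hg B S i (Finset.mem_powerset.1 hB) hi) ?_
      exact mul_nonneg (pow_nonneg ht0 _) (pow_nonneg (sub_nonneg.2 ht1) _)
    simp only [mul_add, Finset.sum_add_distrib] at h1
    rw [← Finset.sum_mul, ← Finset.sum_mul, sum_bernoulliWeight, one_mul, one_mul] at h1
    have h2 := mul_le_mul_of_nonneg_left h1 ht0
    linarith

end Coins

/-! ### Orderings of the members of a family -/

section Orderings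

variable {X : Type*} {d r : ℕ}

/-- The sample space: a member `(S₁, …, S_d)` of `F` together with an injection of `Fin r` into
every `Sᵢ`. When the `Sᵢ` have `r` elements, this is an ordering of every `Sᵢ`. -/
abbrev TupleOrdering (r : ℕ) (F : Finset (Fin d → Finset X)) : Type _ :=
  Σ S : {S // S ∈ F}, ∀ i, Fin r ↪ {x // x ∈ S.1 i}

variable {F : Finset (Fin d → Finset X)}

/-- The `k`-th element, in the chosen order, of the `i`-th set. -/
def coord (ω : TupleOrdering r F) (i : Fin d) (k : Fin r) : X :=
  ω.2 i k

lemma coord_injective (ω : TupleOrdering r F) (i : Fin d) : Function.Injective (coord ω i) :=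
  Subtype.val_injective.comp (ω.2 i).injective

lemma coord_mem (ω : TupleOrdering r F) (i : Fin d) (k : Fin r) : coord ω i k ∈ ω.1.1 i :=
  (ω.2 i k).2

/-- The random variable that reveals the elements at the positions in `K`. -/
def obs (K : Set (Fin d × Fin r)) (ω : TupleOrdering r F) : K → X :=
  fun q => coord ω q.1.1 q.1.2

lemma obs_eq_iff (K : Set (Fin d × Fin r)) (ω ω' : TupleOrdering r F) :
    obs K ω = obs K ω' ↔ ∀ q ∈ K, coord ω q.1 q.2 = coord ω' q.1 q.2 := by
  simp [obs, funext_iff]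

lemma obs_union_eq_iff (K L : Set (Fin d × Fin r)) (ω ω' : TupleOrdering r F) :
    obs (K ∪ L) ω = obs (K ∪ L) ω' ↔ obs K ω = obs K ω' ∧ obs L ω = obs L ω' := by
  simp only [obs_eq_iff, Set.mem_union, or_imp, forall_and]

/-- The first `j` positions of each of the `d` sets. -/
def initialPositions (d r j : ℕ) : Set (Fin d × Fin r) := {q | q.2.val < j}

/-- Position `b` of those of the `d` sets whose index lies in `B`. -/
def layer (b : Fin r) (B : Finset (Fin d)) : Set (Fin d × Fin r) := {q | q.2 = b ∧ q.1 ∈ B}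

/-- Exchange the elements at positions `a` and `b` in the sets whose index lies in `B`. -/
def swapAt (a b : Fin r) (B : Finset (Fin d)) (ω : TupleOrdering r F) : TupleOrdering r F :=
  ⟨ω.1, fun i =>
    (if i ∈ B then Equiv.swap a b else Equiv.refl (Fin r)).toEmbedding.trans (ω.2 i)⟩

lemma coord_swapAt_of_mem (a b : Fin r) {B : Finset (Fin d)} (ω : TupleOrdering r F) {i : Fin d}
    (hi : i ∈ B) (k : Fin r) : coord (swapAt a b B ω) i k = coord ω i (Equiv.swap a b k) := by
  change ((ω.2 i ((if i ∈ B then Equiv.swap a b else Equiv.refl (Fin r)) k) : _) : X) = _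
  rw [if_pos hi]
  rfl

lemma coord_swapAt_of_notMem (a b : Fin r) {B : Finset (Fin d)} (ω : TupleOrdering r F)
    {i : Fin d} (hi : i ∉ B) (k : Fin r) : coord (swapAt a b B ω) i k = coord ω i k := by
  change ((ω.2 i ((if i ∈ B then Equiv.swap a b else Equiv.refl (Fin r)) k) : _) : X) = _
  rw [if_neg hi]
  rfl

lemma swapAt_swapAt (a b : Fin r) (B : Finset (Fin d)) (ω : TupleOrdering r F) :
    swapAt a b B (swapAt a b B ω) = ω := by
  refine Sigma.ext rfl (heq_of_eq (funext fun i => ?_))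
  refine Function.Embedding.ext fun k => Subtype.ext ?_
  change coord (swapAt a b B (swapAt a b B ω)) i k = coord ω i k
  by_cases hi : i ∈ B
  · rw [coord_swapAt_of_mem _ _ _ hi, coord_swapAt_of_mem _ _ _ hi, Equiv.swap_apply_self]
  · rw [coord_swapAt_of_notMem _ _ _ hi, coord_swapAt_of_notMem _ _ _ hi]

/-- `swapAt`, with the set of indices taken from the second component, as a permutation. -/
def swapEquiv (F : Finset (Fin d → Finset X)) (a b : Fin r) :
    TupleOrdering r F × Finset (Fin d) ≃ TupleOrdering r F × Finset (Fin d) where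
  toFun x := (swapAt a b x.2 x.1, x.2)
  invFun x := (swapAt a b x.2 x.1, x.2)
  left_inv x := by simp [swapAt_swapAt]
  right_inv x := by simp [swapAt_swapAt]

lemma image_coord [DecidableEq X] (hF : ∀ S ∈ F, ∀ i, (S i).card = r) (ω : TupleOrdering r F)
    (i : Fin d) : Finset.univ.image (coord ω i) = ω.1.1 i := by
  refine Finset.eq_of_subset_of_card_le ?_ ?_
  · intro x hx
    obtain ⟨k, -, rfl⟩ := Finset.mem_image.1 hx
    exact coord_mem ω i k
  · rw [Finset.card_image_of_injective _ (coord_injective ω i), hF _ ω.1.2]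
    simp

lemma obs_initialPositions_injective (hF : ∀ S ∈ F, ∀ i, (S i).card = r) :
    Function.Injective (obs (F := F) (initialPositions d r r)) := by
  classical
  intro ω ω' h
  rw [obs_eq_iff] at h
  have hc : ∀ i, coord ω i = coord ω' i := fun i => funext fun k => h (i, k) k.2
  have hS : ω.1 = ω'.1 := Subtype.ext <| funext fun i => by
    rw [← image_coord hF, ← image_coord hF, hc]
  obtain ⟨S, e⟩ := ω
  obtain ⟨S', e'⟩ := ω'
  obtain rfl : S = S' := hS
  refine Sigma.ext rfl (heq_of_eq (funext fun i => ?_))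
  ext k
  exact congrFun (hc i) k

lemma card_tupleOrdering (hF : ∀ S ∈ F, ∀ i, (S i).card = r) :
    Fintype.card (TupleOrdering r F) = F.card * r.factorial ^ d := by
  rw [Fintype.card_sigma, Finset.sum_congr rfl fun S _ => ?_, Finset.sum_const, smul_eq_mul,
    Finset.card_univ, Fintype.card_coe]
  rw [Fintype.card_pi, Finset.prod_congr rfl fun i _ => ?_, Finset.prod_const, Finset.card_univ,
    Fintype.card_fin]
  rw [Fintype.card_embedding_eq, Fintype.card_coe, hF _ S.2, Fintype.card_fin,
    Nat.descFactorial_self]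

lemma card_of_mem_tupleShadow [DecidableEq X] {n : ℕ} (hF : ∀ S ∈ F, ∀ i, (S i).card = n + 1) :
    ∀ S ∈ tupleShadow F, ∀ i, (S i).card = n := by
  intro T hT i
  obtain ⟨S, hS, hT⟩ := Finset.mem_biUnion.1 hT
  obtain ⟨x, hx, rfl⟩ := Finset.mem_image.1 hT
  dsimp only
  rw [Finset.sdiff_singleton_eq_erase, Finset.card_erase_of_mem (Fintype.mem_piFinset.1 hx i),
    hF S hS, Nat.add_sub_cancel]

/-- Omitting the last element of every set turns an ordering of a member of `F` into an ordering
of a member of the shadow. -/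
lemma exists_tupleOrdering_shadow [DecidableEq X] {n : ℕ} (ω : TupleOrdering (n + 1) F) :
    ∃ κ : TupleOrdering n (tupleShadow F), ∀ i k, coord κ i k = coord ω i k.castSucc := by
  have hT : (fun i => ω.1.1 i \ {coord ω i (Fin.last n)}) ∈ tupleShadow F :=
    Finset.mem_biUnion.2 ⟨ω.1.1, ω.1.2, Finset.mem_image.2
      ⟨fun i => coord ω i (Fin.last n), Fintype.mem_piFinset.2 fun i => coord_mem ω i _, rfl⟩⟩
  refine ⟨⟨⟨_, hT⟩, fun i => ⟨fun k => ⟨coord ω i k.castSucc, ?_⟩, ?_⟩⟩, fun i k => rfl⟩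
  · rw [Finset.mem_sdiff, Finset.mem_singleton]
    exact ⟨coord_mem ω i _, fun h => (Fin.castSucc_lt_last k).ne (coord_injective ω i h)⟩
  · intro k l h
    exact Fin.castSucc_injective n (coord_injective ω i (congrArg Subtype.val h :))

/-- Every element of a member of `F` comes first in some ordering. -/
lemma exists_coord_eq (hF : ∀ S ∈ F, ∀ i, (S i).card = r) {S : Fin d → Finset X} (hS : S ∈ F)
    {i : Fin d} {x : X} (hx : x ∈ S i) (a : Fin r) : ∃ ω : TupleOrdering r F, coord ω i a = x := by
  have e : ∀ i, Fin r ≃ {x // x ∈ S i} := fun i =>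
    (Fintype.equivFinOfCardEq (by rw [Fintype.card_coe, hF S hS])).symm
  let ω : TupleOrdering r F := ⟨⟨S, hS⟩, fun i => (e i).toEmbedding⟩
  refine ⟨swapAt a ((e i).symm ⟨x, hx⟩) Finset.univ ω, ?_⟩
  rw [coord_swapAt_of_mem _ _ _ (Finset.mem_univ i), Equiv.swap_apply_left]
  simp [coord, ω]

/-! ### Entropy of the uniformly random ordering -/

/-- The uniform weight function on the orderings. -/
noncomputable def unif (r : ℕ) (F : Finset (Fin d → Finset X)) : TupleOrdering r F → ℝ :=
  fun _ => (Fintype.card (TupleOrdering r F) : ℝ)⁻¹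

/-- The entropy of the elements at the positions in `K` of a uniformly random ordering. -/
noncomputable def obsEntropy (F : Finset (Fin d → Finset X)) (K : Set (Fin d × Fin r)) : ℝ :=
  entropy (unif r F) (obs K)

lemma unif_pos (ω : TupleOrdering r F) : 0 < unif r F ω :=
  inv_pos.2 (Nat.cast_pos.2 (Fintype.card_pos_iff.2 ⟨ω⟩))

lemma sum_unif [Nonempty (TupleOrdering r F)] : ∑ ω, unif r F ω = 1 := by
  simp only [unif, Finset.sum_const, Finset.card_univ, nsmul_eq_mul]
  exact mul_inv_cancel₀ (Nat.cast_ne_zero.2 Fintype.card_ne_zero)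

lemma obsEntropy_submodular (K L M N : Set (Fin d × Fin r)) (h1 : M = K ∪ L) (h2 : N ⊆ K)
    (h3 : N ⊆ L) : obsEntropy F M + obsEntropy F N ≤ obsEntropy F K + obsEntropy F L := by
  subst h1
  refine entropy_submodular unif_pos (obs_union_eq_iff K L) (fun x y => ?_) (fun x y => ?_) <;>
    simp only [obs_eq_iff]
  · exact fun h q hq => h q (h2 hq)
  · exact fun h q hq => h q (h3 hq)

lemma obsEntropy_initialPositions_zero [Nonempty (TupleOrdering r F)] :
    obsEntropy F (initialPositions d r 0) = 0 :=
  entropy_of_const sum_unif fun x y => by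
    rw [obs_eq_iff]
    exact fun q hq => absurd hq (Nat.not_lt_zero _)

lemma obsEntropy_initialPositions_self [Nonempty (TupleOrdering r F)]
    (hF : ∀ S ∈ F, ∀ i, (S i).card = r) :
    obsEntropy F (initialPositions d r r) = Real.log (F.card * r.factorial ^ d : ℕ) := by
  rw [← card_tupleOrdering hF, obsEntropy, entropy]
  simp only [fiberMass_of_injective _ (obs_initialPositions_injective hF)]
  simp only [unif, Real.log_inv, Finset.sum_const, Finset.card_univ, nsmul_eq_mul]
  rw [← mul_assoc, mul_inv_cancel₀ (Nat.cast_ne_zero.2 Fintype.card_ne_zero), one_mul, neg_neg]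

lemma obsEntropy_initialPositions_le [DecidableEq X] {n : ℕ}
    [Nonempty (TupleOrdering (n + 1) F)]
    (hF : ∀ S ∈ F, ∀ i, (S i).card = n + 1) :
    obsEntropy F (initialPositions d (n + 1) n) ≤
      Real.log ((tupleShadow F).card * n.factorial ^ d : ℕ) := by
  rw [← card_tupleOrdering (card_of_mem_tupleShadow hF)]
  refine entropy_le_log_card unif_pos sum_unif _
    (fun κ (q : initialPositions d (n + 1) n) => coord κ q.1.1 ⟨q.1.2.val, q.2⟩) fun ω => ?_
  obtain ⟨κ, hκ⟩ := exists_tupleOrdering_shadow ω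
  exact ⟨κ, funext fun q => hκ _ _⟩

/-! ### The mixture inequality -/

/-- The weight function of a uniformly random ordering together with an independent random subset
of the `d` indices. -/
noncomputable def coinWeight (r : ℕ) (F : Finset (Fin d → Finset X)) (t : ℝ) :
    TupleOrdering r F × Finset (Fin d) → ℝ :=
  fun x => unif r F x.1 * bernoulliWeight t Finset.univ x.2

lemma bernoulliWeight_pos {ι : Type*} {t : ℝ} (h0 : 0 < t) (h1 : t < 1) (S B : Finset ι) :
    0 < bernoulliWeight t S B :=
  mul_pos (pow_pos h0 _) (pow_pos (sub_pos.2 h1) _)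

lemma coinWeight_pos {t : ℝ} (h0 : 0 < t) (h1 : t < 1) (x : TupleOrdering r F × Finset (Fin d)) :
    0 < coinWeight r F t x :=
  mul_pos (unif_pos x.1) (bernoulliWeight_pos h0 h1 _ _)

lemma sum_bernoulliWeight_univ {ι : Type*} [Fintype ι] (t : ℝ) :
    ∑ B : Finset ι, bernoulliWeight t Finset.univ B = 1 := by
  rw [← sum_bernoulliWeight t (Finset.univ : Finset ι), Finset.powerset_univ]

lemma coinWeight_swapEquiv (t : ℝ) (a b : Fin r) (x : TupleOrdering r F × Finset (Fin d)) :
    coinWeight r F t (swapEquiv F a b x) = coinWeight r F t x := rfl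

lemma log_bernoulliWeight_univ {t : ℝ} (h0 : 0 < t) (h1 : t < 1) (B : Finset (Fin d)) :
    Real.log (bernoulliWeight t Finset.univ B) =
      d * Real.log (1 - t) - B.card * (Real.log (1 - t) - Real.log t) := by
  have hB : B.card ≤ d := by simpa using Finset.card_le_univ B
  rw [bernoulliWeight, Real.log_mul (pow_pos h0 _).ne' (pow_pos (sub_pos.2 h1) _).ne',
    Real.log_pow, Real.log_pow, Finset.card_univ, Fintype.card_fin, Nat.cast_sub hB]
  ring

/-- For consecutive positions `a` and `b`, the exchanged elements up to position `a`, together with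
the original ones, determine and are determined by the set `B` where the exchange took place and the
elements up to position `a`, and at position `b` for the indices in `B`. -/
lemma swapped_eq_iff {a b : Fin r} (hab : b.val = a.val + 1)
    (x y : TupleOrdering r F × Finset (Fin d)) :
    (obs (initialPositions d r b) (swapAt a b x.2 x.1), obs (initialPositions d r b) x.1) =
        (obs (initialPositions d r b) (swapAt a b y.2 y.1), obs (initialPositions d r b) y.1) ↔
      x.2 = y.2 ∧ obs (initialPositions d r b ∪ layer b x.2) x.1 =
        obs (initialPositions d r b ∪ layer b x.2) y.1 := by
  obtain ⟨ω, B⟩ := x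
  obtain ⟨ω', B'⟩ := y
  have ha : ∀ i : Fin d, (i, a) ∈ initialPositions d r b := fun i => by
    simp [initialPositions, hab]
  have hne : b ≠ a := fun h => by rw [h] at hab; omega
  simp only [Prod.mk.injEq, obs_eq_iff, Set.mem_union, or_imp, forall_and]
  constructor
  · rintro ⟨hz, hv⟩
    have hB : B = B' := by
      ext i
      have h1 := hz _ (ha i)
      have h2 := hv _ (ha i)
      by_cases hi : i ∈ B <;> by_cases hi' : i ∈ B' <;> simp only [hi, hi'] <;>
        exfalso <;> simp only at h1 h2
      · rw [coord_swapAt_of_mem _ _ _ hi, coord_swapAt_of_notMem _ _ _ hi',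
          Equiv.swap_apply_left, ← h2] at h1
        exact hne (coord_injective ω i h1)
      · rw [coord_swapAt_of_notMem _ _ _ hi, coord_swapAt_of_mem _ _ _ hi',
          Equiv.swap_apply_left, h2] at h1
        exact hne (coord_injective ω' i h1).symm
    subst hB
    refine ⟨rfl, hv, ?_⟩
    rintro ⟨i, k⟩ ⟨rfl, hi⟩
    have h1 := hz _ (ha i)
    simpa only [coord_swapAt_of_mem _ _ _ hi, Equiv.swap_apply_left] using h1
  · rintro ⟨rfl, hv, hl⟩
    refine ⟨?_, hv⟩
    rintro ⟨i, k⟩ hk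
    by_cases hi : i ∈ B
    · simp only [coord_swapAt_of_mem _ _ _ hi]
      by_cases hka : k = a
      · rw [hka, Equiv.swap_apply_left]
        exact hl (i, b) ⟨rfl, hi⟩
      · rw [Equiv.swap_apply_of_ne_of_ne hka fun h => by
          subst h; exact lt_irrefl _ (show k.val < k.val from hk)]
        exact hv _ hk
    · simp only [coord_swapAt_of_notMem _ _ _ hi]
      exact hv _ hk

/-- Lower bound for the entropy of the mixture. The set `B` of exchanged indices contributes the
entropy of `d` coins, and by the Shearer-type inequality revealing position `b` on the random set
`B` contributes at least `t` times the entropy of the full layer; `t = y / (1 + y)` maximises the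
resulting bound. -/
lemma le_entropy_swapped [Nonempty (TupleOrdering r F)] {a b : Fin r} (hab : b.val = a.val + 1)
    {y : ℝ} (hy : 0 < y)
    (hH : obsEntropy F (initialPositions d r (b + 1)) - obsEntropy F (initialPositions d r b) =
      d * Real.log y) :
    d * Real.log (1 + y) + obsEntropy F (initialPositions d r b) ≤
      entropy (coinWeight r F (y / (1 + y))) fun x =>
        (obs (initialPositions d r b) (swapAt a b x.2 x.1), obs (initialPositions d r b) x.1) := by
  have hy1 : 0 < 1 + y := by linarith
  set t := y / (1 + y) with ht
  have ht0 : 0 < t := div_pos hy hy1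
  have h1t : 1 - t = (1 + y)⁻¹ := by rw [ht]; field_simp; ring
  have ht1 : t < 1 := by have := inv_pos.2 hy1; linarith
  have hlog1 : Real.log (1 - t) = -Real.log (1 + y) := by rw [h1t, Real.log_inv]
  have hlogt : Real.log t = Real.log y - Real.log (1 + y) := by
    rw [ht, Real.log_div hy.ne' hy1.ne']
  set K := initialPositions d r b with hK
  have hfull : initialPositions d r (b + 1) = K ∪ layer b Finset.univ := by
    ext ⟨i, k⟩
    simp only [hK, initialPositions, layer, Set.mem_union, Set.mem_ofPred_eq, Finset.mem_univ,
      and_true, Fin.ext_iff]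
    omega
  have hempty : K ∪ layer b ∅ = K := by simp [layer]
  rw [hfull] at hH
  have hent := entropy_prod_of_snd (p := unif r F) unif_pos sum_unif
    (w := fun B : Finset (Fin d) => bernoulliWeight t Finset.univ B)
    (fun B => bernoulliWeight_pos ht0 ht1 _ B) (g := fun B => obs (K ∪ layer b B))
    (f := fun x => (obs K (swapAt a b x.2 x.1), obs K x.1)) (swapped_eq_iff hab)
  have hsh := mul_le_sum_bernoulliWeight ht0.le ht1.le
    (fun B : Finset (Fin d) => obsEntropy F (K ∪ layer b B) - obsEntropy F K -
      B.card * Real.log y) (by simp [hempty]) (by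
      intro B S i hBS hi
      have := obsEntropy_submodular (F := F) (K ∪ layer b (insert i B)) (K ∪ layer b S)
        (K ∪ layer b (insert i S)) (K ∪ layer b B) (by
          ext ⟨j, k⟩
          have := @hBS j
          simp only [layer, Set.mem_union, Set.mem_ofPred_eq, Finset.mem_insert]
          tauto) (by
          rintro ⟨j, k⟩
          simp only [layer, Set.mem_union, Set.mem_ofPred_eq, Finset.mem_insert]
          tauto) (by
          rintro ⟨j, k⟩
          have := @hBS j
          simp only [layer, Set.mem_union, Set.mem_ofPred_eq]
          tauto)
      rw [Finset.card_insert_of_notMem hi, Finset.card_insert_of_notMem fun h => hi (hBS h)]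
      push_cast
      linarith) Finset.univ
  rw [Finset.powerset_univ] at hsh
  simp only [Finset.card_univ, Fintype.card_fin] at hsh
  rw [hH, sub_self, mul_zero] at hsh
  have hsplit : ∑ B : Finset (Fin d), bernoulliWeight t Finset.univ B *
      (-Real.log (bernoulliWeight t Finset.univ B) + obsEntropy F (K ∪ layer b B)) =
      ∑ B : Finset (Fin d), bernoulliWeight t Finset.univ B *
        (obsEntropy F (K ∪ layer b B) - obsEntropy F K - B.card * Real.log y) +
      (∑ B : Finset (Fin d), bernoulliWeight t Finset.univ B) *
        (d * Real.log (1 + y) + obsEntropy F K) := by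
    rw [Finset.sum_mul, ← Finset.sum_add_distrib]
    refine Finset.sum_congr rfl fun B _ => ?_
    rw [log_bernoulliWeight_univ ht0 ht1, hlog1, hlogt]
    ring
  rw [sum_bernoulliWeight_univ, one_mul] at hsplit
  exact ((le_add_of_nonneg_left hsh).trans_eq hsplit.symm).trans_eq hent.symm

/-- If revealing position `b` adds entropy `d log y`, then revealing the preceding position adds
entropy at least `d log (1 + y)`. The mixture of the two layers has the distribution of the
earlier one. -/
theorem mul_log_one_add_le [Nonempty (TupleOrdering r F)] {a b : Fin r}
    (hab : b.val = a.val + 1) {y : ℝ} (hy : 0 < y)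
    (hH : obsEntropy F (initialPositions d r (b + 1)) - obsEntropy F (initialPositions d r b) =
      d * Real.log y) :
    d * Real.log (1 + y) ≤
      obsEntropy F (initialPositions d r b) - obsEntropy F (initialPositions d r a) := by
  have hy1 : 0 < 1 + y := by linarith
  have ht0 : 0 < y / (1 + y) := div_pos hy hy1
  have ht1 : y / (1 + y) < 1 := (div_lt_one hy1).2 (by linarith)
  have h1 := le_entropy_swapped hab hy hH
  have h2 := entropy_submodular (p := coinWeight r F (y / (1 + y))) (coinWeight_pos ht0 ht1)
    (fg := fun x => (obs (initialPositions d r b) (swapAt a b x.2 x.1),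
      obs (initialPositions d r b) x.1))
    (f := fun x => obs (initialPositions d r b) (swapAt a b x.2 x.1))
    (g := fun x => obs (initialPositions d r b) x.1)
    (h := fun x => obs (initialPositions d r a) x.1) (fun x y => Prod.mk_inj) (by
      intro x y hxy
      rw [obs_eq_iff] at hxy ⊢
      rintro ⟨i, k⟩ (hk : k.val < a.val)
      have hs : Equiv.swap a b k = k := Equiv.swap_apply_of_ne_of_ne
        (fun h => by rw [h] at hk; omega) (fun h => by rw [h] at hk; omega)
      have hz : ∀ z : TupleOrdering r F × Finset (Fin d),
          coord (swapAt a b z.2 z.1) i k = coord z.1 i k := by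
        intro z
        by_cases hi : i ∈ z.2
        · rw [coord_swapAt_of_mem _ _ _ hi, hs]
        · rw [coord_swapAt_of_notMem _ _ _ hi]
      have := hxy (i, k) (show k.val < b.val by omega)
      simpa only [hz] using this) (by
      intro x y hxy
      rw [obs_eq_iff] at hxy ⊢
      exact fun q hq => hxy q (show q.2.val < b.val by
        have : q.2.val < a.val := hq
        omega))
  have h3 : entropy (coinWeight r F (y / (1 + y)))
      (fun x => obs (initialPositions d r b) x.1) = obsEntropy F (initialPositions d r b) :=
    entropy_prod_fst _ (sum_bernoulliWeight_univ _) fun x y => Iff.rfl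
  have h4 : entropy (coinWeight r F (y / (1 + y)))
      (fun x => obs (initialPositions d r a) x.1) = obsEntropy F (initialPositions d r a) :=
    entropy_prod_fst _ (sum_bernoulliWeight_univ _) fun x y => Iff.rfl
  have h5 := entropy_comp_equiv (swapEquiv F a b) (coinWeight_swapEquiv (y / (1 + y)) a b)
    fun x => obs (initialPositions d r b) x.1
  rw [h3] at h5
  have h6 : entropy (coinWeight r F (y / (1 + y)))
    (fun x => obs (initialPositions d r b) (swapAt a b x.2 x.1)) = _ := h5
  linarith

lemma sum_bernoulliWeight_notMem {ι : Type*} [Fintype ι] [DecidableEq ι] (t : ℝ) (i : ι) :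
    ∑ B : Finset ι, bernoulliWeight t Finset.univ B * (if i ∈ B then 0 else 1) = 1 - t := by
  rw [← Finset.powerset_univ, ← Finset.insert_erase (Finset.mem_univ i),
    sum_bernoulliWeight_insert t (Finset.notMem_erase i _)]
  have h : ∀ B ∈ (Finset.univ.erase i).powerset, i ∉ B := fun B hB hi =>
    Finset.notMem_erase i _ (Finset.mem_powerset.1 hB hi)
  rw [Finset.sum_congr rfl fun B hB => by rw [if_neg (h B hB), mul_one], sum_bernoulliWeight]
  simp

/-- The equality case of `mul_log_one_add_le` at the first position: the mixture of the first two
layers is independent of the first one. Comparing the probabilities that the `i`-th coordinates of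
both are equal to a given element shows that the first element of the `i`-th set is uniformly
distributed on `1 + y` values. -/
theorem fiberMass_coord_of_entropy_eq [Nonempty (TupleOrdering r F)] {a b : Fin r}
    (ha : a.val = 0) (hb : b.val = 1) {y : ℝ} (hy : 0 < y)
    (hH : obsEntropy F (initialPositions d r 2) - obsEntropy F (initialPositions d r 1) =
      d * Real.log y)
    (hH1 : obsEntropy F (initialPositions d r 1) = d * Real.log (1 + y)) (i : Fin d)
    (ω : TupleOrdering r F) : fiberMass (unif r F) (fun ω => coord ω i a) ω = (1 + y)⁻¹ := by
  classical
  have hab : b.val = a.val + 1 := by omega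
  have hba : b ≠ a := fun h => by rw [h] at hb; omega
  have hy1 : 0 < 1 + y := by linarith
  have h1 := le_entropy_swapped (F := F) hab hy (by rw [hb]; exact hH)
  rw [hb, hH1] at h1
  set t := y / (1 + y) with ht
  have ht0 : 0 < t := div_pos hy hy1
  have h1t : 1 - t = (1 + y)⁻¹ := by rw [ht]; field_simp; ring
  have ht1 : t < 1 := by have := inv_pos.2 hy1; linarith
  set K := initialPositions d r 1 with hK
  have hiK : (i, a) ∈ K := by simp [hK, initialPositions, ha]
  set q := coinWeight r F t with hq
  have hqpos : ∀ x, 0 < q x := coinWeight_pos ht0 ht1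
  have hcoord : ∀ ω ω' : TupleOrdering r F, obs K ω = obs K ω' → coord ω i a = coord ω' i a :=
    fun ω ω' h => (obs_eq_iff K ω ω').1 h _ hiK
  have h3 : entropy q (fun x => obs K x.1) = obsEntropy F K :=
    entropy_prod_fst _ (sum_bernoulliWeight_univ _) fun x y => Iff.rfl
  have h4 : entropy q (fun x => obs K (swapAt a b x.2 x.1)) = obsEntropy F K :=
    (entropy_comp_equiv (swapEquiv F a b) (coinWeight_swapEquiv t a b)
      fun x => obs K x.1).trans h3
  -- The `i`-th coordinates inherit independence from the full layers.
  have h5 := entropy_submodular hqpos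
    (fg := fun x => (obs K (swapAt a b x.2 x.1), obs K x.1))
    (f := fun x => obs K (swapAt a b x.2 x.1))
    (g := fun x => (coord (swapAt a b x.2 x.1) i a, obs K x.1))
    (h := fun x => coord (swapAt a b x.2 x.1) i a)
    (fun x y => by
      simp only [Prod.mk.injEq]
      exact ⟨fun h => ⟨h.1, hcoord _ _ h.1, h.2⟩, fun h => ⟨h.1, h.2.2⟩⟩)
    (fun x y h => hcoord _ _ h) (fun x y h => (Prod.mk.inj h).1)
  have h6 := entropy_submodular hqpos
    (fg := fun x => (coord (swapAt a b x.2 x.1) i a, obs K x.1))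
    (f := fun x => (coord (swapAt a b x.2 x.1) i a, coord x.1 i a))
    (g := fun x => obs K x.1)
    (h := fun x => coord x.1 i a)
    (fun x y => by
      simp only [Prod.mk.injEq]
      exact ⟨fun h => ⟨⟨h.1, hcoord _ _ h.2⟩, h.2⟩, fun h => ⟨h.1.1, h.2⟩⟩)
    (fun x y h => (Prod.mk.inj h).2) (fun x y h => hcoord _ _ h)
  have hqsum : ∑ x, q x = 1 := by
    simp only [hq, coinWeight, Fintype.sum_prod_type]
    simp only [← Finset.mul_sum]
    rw [sum_bernoulliWeight_univ]
    simp only [mul_one, sum_unif]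
  have h7 := fiberMass_mul_eq_of_entropy_eq hqpos
    (fg := fun x => (coord (swapAt a b x.2 x.1) i a, coord x.1 i a))
    (f := fun x => coord (swapAt a b x.2 x.1) i a)
    (g := fun x => coord x.1 i a) (h := fun _ => ()) (fun x y => Prod.mk_inj)
    (fun _ _ _ => rfl) (fun _ _ _ => rfl) (by
      rw [entropy_of_const hqsum (f := fun _ => ()) fun _ _ => rfl]
      linarith) (ω, ∅)
  have h8 : ∀ x, fiberMass q (fun x => coord x.1 i a) x =
      fiberMass (unif r F) (fun ω => coord ω i a) x.1 :=
    fiberMass_prod_fst _ (sum_bernoulliWeight_univ _) fun x y => Iff.rfl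
  have h9 : fiberMass q (fun x => coord (swapAt a b x.2 x.1) i a) (ω, ∅) =
      fiberMass (unif r F) (fun ω => coord ω i a) ω := by
    refine (fiberMass_comp_equiv (swapEquiv F a b) (coinWeight_swapEquiv t a b)
      (fun x => coord x.1 i a) (ω, ∅)).trans ((h8 _).trans (fiberMass_eq_of_eq _ ?_))
    exact coord_swapAt_of_notMem a b ω (Finset.notMem_empty i) a
  have h10 : fiberMass q (fun x => (coord (swapAt a b x.2 x.1) i a, coord x.1 i a)) (ω, ∅) =
      (1 - t) * fiberMass (unif r F) (fun ω => coord ω i a) ω := by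
    rw [fiberMass, fiberMass, ← sum_bernoulliWeight_notMem t i, Finset.sum_mul_sum,
      Fintype.sum_prod_type_right]
    refine Finset.sum_congr rfl fun B _ => Finset.sum_congr rfl fun ω' _ => ?_
    simp only [Prod.mk.injEq, coord_swapAt_of_notMem a b ω (Finset.notMem_empty i) a]
    by_cases hi : i ∈ B
    · rw [coord_swapAt_of_mem _ _ _ hi, Equiv.swap_apply_left, if_neg, if_pos hi, mul_zero,
        zero_mul]
      rintro ⟨h, h'⟩
      exact hba (coord_injective ω' i (h.trans h'.symm))
    · simp only [coord_swapAt_of_notMem _ _ _ hi, and_self, if_neg hi, mul_one]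
      split_ifs
      · simp only [hq, coinWeight]
        ring
      · rw [mul_zero]
  rw [h9, h8, h10, fiberMass_of_const q (f := fun _ => ()) fun _ _ => rfl, hqsum, mul_one] at h7
  rw [← h1t]
  exact mul_right_cancel₀ (fiberMass_pos unif_pos _ ω).ne' h7

end Orderings

/-! ### The chain of conditional entropies -/

/-- A sequence that decreases by at least one in every step and has the same product as
`x, x - 1, …, x - n` cannot end above `x - n` unless it is that sequence. -/
lemma eq_sub_of_prod_eq {n : ℕ} {a : ℕ → ℝ} {x : ℝ} (hx : (n : ℝ) + 1 ≤ x)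
    (hstep : ∀ j < n, a (j + 1) + 1 ≤ a j)
    (hprod : ∏ j ∈ Finset.range (n + 1), a j = ∏ j ∈ Finset.range (n + 1), (x - j))
    (hn : x - n ≤ a n) : ∀ j ≤ n, a j = x - j := by
  have hle : ∀ j ≤ n, x - j ≤ a j := by
    intro j hj
    induction hj using Nat.decreasingInduction with
    | self => exact hn
    | of_succ k hk ih =>
      have := hstep k hk
      push_cast at ih
      linarith
  intro j hj
  by_contra hne
  refine (Finset.prod_lt_prod (fun i hi => ?_) (fun i hi => ?_) ⟨j, ?_, ?_⟩).ne' hprod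
  · have : (i : ℝ) ≤ n := Nat.cast_le.2 (Nat.lt_succ_iff.1 (Finset.mem_range.1 hi))
    linarith
  · exact hle i (Nat.lt_succ_iff.1 (Finset.mem_range.1 hi))
  · exact Finset.mem_range.2 (Nat.lt_succ_iff.2 hj)
  · exact lt_of_le_of_ne (hle j hj) (Ne.symm hne)

lemma realBinom_mul_factorial (x : ℝ) (k : ℕ) :
    realBinom x k * k.factorial = ∏ i ∈ Finset.range k, (x - i) :=
  div_mul_cancel₀ _ (Nat.cast_ne_zero.2 k.factorial_ne_zero)

lemma realBinom_natCast (m k : ℕ) : realBinom m k = m.choose k := by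
  rw [realBinom, ← descPochhammer_eval_eq_prod_range, Nat.cast_choose_eq_descPochhammer_div]

section Chain

variable {X : Type*} {d r n : ℕ} {F : Finset (Fin d → Finset X)}

/-- The normalised exponential `exp (H / d)` of the entropy `H` that position `j` adds to the
positions before it. -/
noncomputable def effectiveChoices (r : ℕ) (F : Finset (Fin d → Finset X)) (j : ℕ) : ℝ :=
  Real.exp ((obsEntropy F (initialPositions d r (j + 1)) -
    obsEntropy F (initialPositions d r j)) / d)

lemma effectiveChoices_pos (j : ℕ) : 0 < effectiveChoices r F j := Real.exp_pos _

lemma mul_log_effectiveChoices (hd : 0 < d) (j : ℕ) :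
    d * Real.log (effectiveChoices r F j) =
      obsEntropy F (initialPositions d r (j + 1)) - obsEntropy F (initialPositions d r j) := by
  rw [effectiveChoices, Real.log_exp]
  exact mul_div_cancel₀ _ (Nat.cast_ne_zero.2 hd.ne')

lemma prod_effectiveChoices_pow [Nonempty (TupleOrdering r F)] (hd : 0 < d) (m : ℕ) :
    (∏ j ∈ Finset.range m, effectiveChoices r F j) ^ d =
      Real.exp (obsEntropy F (initialPositions d r m)) := by
  simp only [effectiveChoices]
  rw [← Real.exp_sum, ← Finset.sum_div,
    Finset.sum_range_sub fun j => obsEntropy F (initialPositions d r j),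
    obsEntropy_initialPositions_zero, sub_zero, ← Real.exp_nat_mul]
  rw [mul_div_cancel₀ _ (Nat.cast_ne_zero.2 hd.ne')]

lemma effectiveChoices_succ_add_one_le [Nonempty (TupleOrdering r F)] (hd : 0 < d) {j : ℕ}
    (hj : j + 1 < r) : effectiveChoices r F (j + 1) + 1 ≤ effectiveChoices r F j := by
  have hpos : 0 < effectiveChoices r F (j + 1) := effectiveChoices_pos _
  have h := mul_log_one_add_le (F := F) (a := ⟨j, by omega⟩) (b := ⟨j + 1, hj⟩) rfl hpos
    (mul_log_effectiveChoices hd (j + 1)).symm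
  dsimp only at h
  rw [← mul_log_effectiveChoices hd j, mul_le_mul_iff_right₀ (Nat.cast_pos.2 hd),
    Real.log_le_log_iff (by linarith) (effectiveChoices_pos j)] at h
  linarith

lemma prod_effectiveChoices_self [Nonempty (TupleOrdering r F)] (hd : 0 < d)
    (hF : ∀ S ∈ F, ∀ i, (S i).card = r) {x : ℝ} (hx : (r : ℝ) ≤ x)
    (hcard : (F.card : ℝ) = realBinom x r ^ d) :
    ∏ j ∈ Finset.range r, effectiveChoices r F j = ∏ j ∈ Finset.range r, (x - j) := by
  have hP : 0 < ∏ j ∈ Finset.range r, (x - j) := Finset.prod_pos fun j hj => by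
    have : (j : ℝ) < r := Nat.cast_lt.2 (Finset.mem_range.1 hj)
    linarith
  rw [← pow_left_inj₀ (Finset.prod_nonneg fun j _ => (effectiveChoices_pos j).le) hP.le hd.ne',
    prod_effectiveChoices_pow hd, obsEntropy_initialPositions_self hF, Nat.cast_mul, Nat.cast_pow,
    hcard, ← mul_pow, realBinom_mul_factorial, Real.exp_log (pow_pos hP d)]

lemma exp_obsEntropy_le [DecidableEq X] [Nonempty (TupleOrdering (n + 1) F)]
    (hF : ∀ S ∈ F, ∀ i, (S i).card = n + 1) :
    Real.exp (obsEntropy F (initialPositions d (n + 1) n)) ≤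
      (tupleShadow F).card * (n.factorial : ℝ) ^ d := by
  obtain ⟨κ, -⟩ := exists_tupleOrdering_shadow (Classical.arbitrary (TupleOrdering (n + 1) F))
  have hpos : 0 < (tupleShadow F).card := Finset.card_pos.2 ⟨_, κ.1.2⟩
  have h := Real.exp_le_exp.2 (obsEntropy_initialPositions_le hF)
  rw [Real.exp_log (by positivity)] at h
  exact_mod_cast h

/-! ### The equality case -/

/-- If the element at some fixed position `a` of every set is uniformly distributed on `x` values, then `F` is contained
in a product family of the same cardinality. -/
lemma eq_productFamily_of_fiberMass [DecidableEq X] [Nonempty (TupleOrdering r F)]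
    (hF : ∀ S ∈ F, ∀ i, (S i).card = r) {x : ℝ} (hcard : (F.card : ℝ) = realBinom x r ^ d)
    (a : Fin r) (h : ∀ i ω, fiberMass (unif r F) (fun ω => coord ω i a) ω = x⁻¹) :
    ∃ Y : Fin d → Finset X, F = productFamily r Y := by
  let Y : Fin d → Finset X := fun i =>
    Finset.univ.image fun ω : TupleOrdering r F => coord ω i a
  have hY : ∀ i, ((Y i).card : ℝ) = x := by
    intro i
    rw [← sum_div_fiberMass (p := unif r F) unif_pos]
    simp only [h, div_inv_eq_mul]
    rw [← Finset.sum_mul, sum_unif, one_mul]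
  refine ⟨Y, Finset.eq_of_subset_of_card_le ?_ ?_⟩
  · intro S hS
    refine Fintype.mem_piFinset.2 fun i => Finset.mem_powersetCard.2 ⟨fun v hv => ?_, hF S hS i⟩
    obtain ⟨ω, hω⟩ := exists_coord_eq hF hS hv a
    exact Finset.mem_image.2 ⟨ω, Finset.mem_univ ω, hω⟩
  · rw [← Nat.cast_le (α := ℝ), hcard, productFamily, Fintype.card_piFinset]
    push_cast
    simp only [Finset.card_powersetCard, ← realBinom_natCast, hY, Finset.prod_const,
      Finset.card_univ, Fintype.card_fin, le_refl]

/-- For `d = r = 1` there is no second layer to compare with, but the only coordinate determines the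
ordering and is therefore uniform. -/
lemma fiberMass_coord_of_one {F : Finset (Fin 1 → Finset X)} [Nonempty (TupleOrdering 1 F)]
    (hF : ∀ S ∈ F, ∀ i, (S i).card = 1) {x : ℝ} (hcard : (F.card : ℝ) = x) (i : Fin 1)
    (ω : TupleOrdering 1 F) : fiberMass (unif 1 F) (fun ω => coord ω i 0) ω = x⁻¹ := by
  have hinj : Function.Injective fun ω : TupleOrdering 1 F => coord ω i 0 := by
    intro ω ω' h
    refine obs_initialPositions_injective hF ((obs_eq_iff _ _ _).2 ?_)
    rintro ⟨j, k⟩ -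
    rw [Subsingleton.elim j i, Subsingleton.elim k 0]
    exact h
  rw [fiberMass_of_injective _ hinj, unif, card_tupleOrdering hF, ← hcard]
  simp

end Chain

theorem theorem1 {X : Type*} [DecidableEq X] (d r : ℕ) (hr : 1 ≤ r)
    (F : Finset (Fin d → Finset X)) (hF : ∀ S ∈ F, ∀ i, (S i).card = r)
    (x : ℝ) (hx : (r : ℝ) ≤ x) (hcard : (F.card : ℝ) = realBinom x r ^ d) :
    realBinom x (r - 1) ^ d ≤ ((tupleShadow F).card : ℝ) ∧
      ((2 ≤ r ∨ d = 1) → ((tupleShadow F).card : ℝ) = realBinom x (r - 1) ^ d →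
        ∃ Y : Fin d → Finset X, F = productFamily r Y) := by
  obtain ⟨n, rfl⟩ : ∃ n, r = n + 1 := ⟨r - 1, by omega⟩
  rw [Nat.add_sub_cancel]
  have hterm : ∀ j ∈ Finset.range (n + 1), 0 < x - j := fun j hj => by
    have : (j : ℝ) < (n + 1 : ℕ) := Nat.cast_lt.2 (Finset.mem_range.1 hj)
    linarith
  have hFpos : 0 < F.card := by
    rw [← Nat.cast_pos (α := ℝ), hcard]
    exact pow_pos (div_pos (Finset.prod_pos hterm) (Nat.cast_pos.2 (Nat.factorial_pos _))) _
  have : Nonempty (TupleOrdering (n + 1) F) := by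
    rw [← Fintype.card_pos_iff, card_tupleOrdering hF]
    exact Nat.mul_pos hFpos (pow_pos (Nat.factorial_pos _) _)
  have hle := exp_obsEntropy_le (n := n) hF
  rcases Nat.eq_zero_or_pos d with rfl | hd
  · refine ⟨?_, fun _ _ => ⟨fun i => i.elim0, ?_⟩⟩
    · obtain ⟨κ, -⟩ := exists_tupleOrdering_shadow (Classical.arbitrary (TupleOrdering (n + 1) F))
      rw [pow_zero, Nat.one_le_cast]
      exact Finset.card_pos.2 ⟨_, κ.1.2⟩
    · rw [pow_zero, Nat.cast_eq_one] at hcard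
      refine Finset.eq_of_subset_of_card_le (fun S _ => ?_) ?_
      · exact Fintype.mem_piFinset.2 fun i => i.elim0
      · rw [hcard, productFamily, Fintype.card_piFinset]
        simp
  set a := effectiveChoices (n + 1) F with ha
  have hapos : ∀ j, 0 < a j := fun j => effectiveChoices_pos j
  have hprod := prod_effectiveChoices_self hd hF hx hcard
  have heq := eq_sub_of_prod_eq (n := n) (a := a) (by exact_mod_cast hx)
    (fun j hj => effectiveChoices_succ_add_one_le hd (by omega)) hprod
  rw [← prod_effectiveChoices_pow hd] at hle
  have hfac : (0 : ℝ) < (n.factorial : ℝ) ^ d := by positivity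
  have hQpos : 0 < ∏ j ∈ Finset.range n, (x - j) := Finset.prod_pos fun j hj =>
    hterm j (Finset.mem_range.2 ((Finset.mem_range.1 hj).trans n.lt_succ_self))
  have hlast : 0 < x - n := hterm n (Finset.mem_range.2 n.lt_succ_self)
  have hbinom : realBinom x n ^ d * (n.factorial : ℝ) ^ d =
      (∏ j ∈ Finset.range n, (x - j)) ^ d := by
    rw [← mul_pow, realBinom_mul_factorial]
  rw [Finset.prod_range_succ, Finset.prod_range_succ] at hprod
  refine ⟨?_, fun hrd hsh => ?_⟩
  · have han : a n ≤ x - n := (le_total (a n) (x - n)).elim id fun h => (heq h n le_rfl).le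
    have hQ : ∏ j ∈ Finset.range n, (x - j) ≤ ∏ j ∈ Finset.range n, a j := by
      refine le_of_mul_le_mul_right ?_ hlast
      rw [← hprod]
      exact mul_le_mul_of_nonneg_left han (Finset.prod_nonneg fun j _ => (hapos j).le)
    refine le_of_mul_le_mul_right ?_ hfac
    rw [hbinom]
    exact (pow_le_pow_left₀ hQpos.le hQ d).trans hle
  · rw [hsh, hbinom] at hle
    have hQ := le_of_pow_le_pow_left₀ hd.ne' hQpos.le hle
    have han : x - n ≤ a n := by
      refine le_of_mul_le_mul_left ?_ hQpos
      rw [← hprod]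
      exact mul_le_mul_of_nonneg_right hQ (hapos n).le
    have hall := heq han
    refine eq_productFamily_of_fiberMass hF hcard 0 fun i ω => ?_
    rcases Nat.eq_zero_or_pos n with rfl | hn
    · obtain rfl : d = 1 := by omega
      exact fiberMass_coord_of_one hF (by simpa [realBinom] using hcard) i ω
    · have h0 := hall 0 n.zero_le
      have h1 := hall 1 hn
      rw [Nat.cast_zero, sub_zero] at h0
      rw [Nat.cast_one] at h1
      have hH0 := mul_log_effectiveChoices (r := n + 1) (F := F) hd 0
      have hH1 := mul_log_effectiveChoices (r := n + 1) (F := F) hd 1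
      rw [obsEntropy_initialPositions_zero, sub_zero] at hH0
      rw [← ha, h0] at hH0
      rw [← ha, h1] at hH1
      have hy : 0 < x - 1 := by
        have := hterm 1 (Finset.mem_range.2 (by omega))
        simpa using this
      have := fiberMass_coord_of_entropy_eq (F := F) (a := 0) (b := ⟨1, by omega⟩) rfl rfl hy
        hH1.symm (by rw [add_sub_cancel]; exact hH0.symm) i ω
      rwa [add_sub_cancel] at this
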